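/- Let $M_\infty>0$ and $V\neq 0$ be real parameters and consider the two-dimensional airfoil model with cubic pitching stiffness \[ \ddot x_1+2G^1(x,y)=0,\qquad \ddot x_2+2G^2(x,y)=0,\qquad y_1=\dot x_1,\ y_2=\dot x_2, \] where \[ \begin{aligned} G^1=\frac{1}{2100V^2M_\infty}\bigl(&6V^2M_\infty^2x_2^3-6000M_\infty x_2^3+30V^2x_2+30V^2y_1+19V^2y_2\\ &+240VM_\infty y_1-60VM_\infty y_2+1200M_\infty x_1-300M_\infty x_2\bigr),\\ G^2=-\frac{1}{5250V^2M_\infty}\bigl(&18V^2M_\infty^2x_2^3-60000M_\infty x_2^3+90V^2x_2+90V^2y_1+85V^2y_2\\ &+300VM_\infty y_1-600VM_\infty y_2+1500M_\infty x_1-3000M_\infty x_2\bigr). \end{aligned} \] A fixed point is a point $\bar x\in\mathbb R^2$ with $G^1(\bar x,0)=G^2(\bar x,0)=0$. It is Jacobi stable if all (complex) eigenvalues of the deviation curvature tensor \[ P^i_j=-2\frac{\partial G^i}{\partial x_j}-2\sum_{\ell} G^\ell\frac{\partial N^i_j}{\partial y_\ell}+\sum_\ell y_\ell\frac{\partial N^i_j}{\partial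 x_\ell}+\sum_\ell N^i_\ell N^\ell_j,\qquad N^i_j=\frac{\partial G^i}{\partial y_j}, \] evaluated at $(x,y)=(\bar x,0)$, have strictly negative real parts. Put \[ \begin{aligned} R_1={}&-9450V^2M_\infty-43V^2+135VM_\infty+621900M_\infty^2,\\ R_2={}&1800V^4M_\infty+1500V^3M_\infty^2-15660000V^2M_\infty^3+4V^4+20V^3M_\infty\\ &-123675V^2M_\infty^2+297000VM_\infty^3+769590000M_\infty^4,\\ R_3={}&-V^2+50M_\infty,\qquad R_4=V^2M_\infty-5000,\\ R_5={}&-18900V^4M_\infty^2+43V^4M_\infty-135V^3M_\infty^2+795600V^2M_\infty^3+47250000V^2M_\infty\\ &-215000V^2+675000VM_\infty-1615500000M_\infty^2,\\ R_6={}&3600V^6M_\infty^2+3000V^5M_\infty^3-31320000V^4M_\infty^4-4V^6M_\infty-20V^5M_\infty^2-146325V^4M_\infty^3\\ &-522000V^3M_\infty^4+1579410000V^2M_\infty^5-4500000V^4M_\infty-532500000V^3M_\infty^2\\ &+155250000000V^2M_\infty^3+20000V^4+100000V^3M_\infty+56625000V^2M_\infty^2\\ &+28485000000VM_\infty^3-7829550000000M_\infty^4,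 \end{aligned} \] and suppose that $(M_\infty,V)$ satisfies the genericity condition \[ \mathcal C^*:\quad (M_\infty-10)\,R_1R_2R_3R_4R_5R_6\neq 0 . \] Then: (a) The system has exactly one Jacobi stable fixed point if and only if one of the following holds: - $\mathcal C_1$: $R_1>0$, $R_2>0$, $R_4>0$, $R_5>0$, $R_6>0$ and $\mathcal C^*$; - $\mathcal C_2$: $R_1>0$, $R_2>0$, $R_3>0$, $R_4<0$ and $\mathcal C^*$; - $\mathcal C_3$: $R_1>0$, $R_2>0$, $R_3>0$, $R_4>0$, $R_5<0$, $R_6>0$ and $\mathcal C^*$. (b) The system has exactly two Jacobi stable fixed points if and only if one of the following holds: - $\mathcal C_4$: $R_1<0$, $R_3<0$, $R_4<0$, $R_5>0$, $R_6>0$ and $\mathcal C^*$; - $\mathcal C_5$: $R_1>0$, $R_2<0$, $R_3<0$, $R_4<0$, $R_5>0$, $R_6>0$ and $\mathcal C^*$. -/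

import Mathlib

/-! ### KCC theory for `x'' i + 2 G i (x, x') = 0`, `i = 1, …, n`, on `ℝⁿ` -/

namespace KCC

variable {n : ℕ}

/-- The partial derivative `∂f/∂v_j` at `v` of a real function of `n` real variables. -/
noncomputable def partialDeriv (f : (Fin n → ℝ) → ℝ) (j : Fin n) (v : Fin n → ℝ) : ℝ :=
  deriv (fun s : ℝ => f (Function.update v j s)) (v j)

/-- The coefficients `N^i_j = ∂G^i/∂y_j` of the nonlinear connection, at `(x, y)`. -/
noncomputable def nonlinearConnection (G : (Fin n → ℝ) → (Fin n → ℝ) → Fin n → ℝ)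
    (i j : Fin n) (x y : Fin n → ℝ) : ℝ :=
  partialDeriv (fun y' => G x y' i) j y

/-- The Berwald connection `G^i_{jl} = ∂N^i_j/∂y_l`, at `(x, y)`. -/
noncomputable def berwaldConnection (G : (Fin n → ℝ) → (Fin n → ℝ) → Fin n → ℝ)
    (i j l : Fin n) (x y : Fin n → ℝ) : ℝ :=
  partialDeriv (fun y' => nonlinearConnection G i j x y') l y

/-- The second KCC invariant (deviation curvature tensor) at `(x, y)`, as the matrix with
row index `i` and column index `j` and entries
`P^i_j = -2 ∂G^i/∂x_j - 2 G^l G^i_{jl} + y_l ∂N^i_j/∂x_l + N^i_l N^l_j` (summed over `l`). -/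
noncomputable def deviationTensor (G : (Fin n → ℝ) → (Fin n → ℝ) → Fin n → ℝ)
    (x y : Fin n → ℝ) : Matrix (Fin n) (Fin n) ℝ :=
  Matrix.of fun i j =>
    -2 * partialDeriv (fun x' => G x' y i) j x
      - 2 * ∑ l, G x y l * berwaldConnection G i j l x y
      + ∑ l, y l * partialDeriv (fun x' => nonlinearConnection G i j x' y) l x
      + ∑ l, nonlinearConnection G i l x y * nonlinearConnection G l j x y

/-- Jacobi stability at `(x, y)`: all complex eigenvalues of the deviation curvature tensor
have strictly negative real part. -/
def JacobiStableAt (G : (Fin n → ℝ) → (Fin n → ℝ) → Fin n → ℝ) (x y : Fin n → ℝ) : Prop :=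
  ∀ z : ℂ, Module.End.HasEigenvalue
    (Matrix.toLin' ((deviationTensor G x y).map (fun r : ℝ => (r : ℂ)))) z → z.re < 0

/-- Fixed points: positions `x` such that the system is at rest at `(x, 0)`. -/
def IsFixedPoint (G : (Fin n → ℝ) → (Fin n → ℝ) → Fin n → ℝ) (x : Fin n → ℝ) : Prop :=
  ∀ i, G x 0 i = 0

/-- The set of Jacobi stable fixed points of the system. -/
def jacobiStableFixedPoints (G : (Fin n → ℝ) → (Fin n → ℝ) → Fin n → ℝ) : Set (Fin n → ℝ) :=
  {x | IsFixedPoint G x ∧ JacobiStableAt G x 0}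

end KCC

/-! ### The airfoil model with cubic pitching stiffness

`M` is the flight Mach number, `V` the dimensionless flow speed; the coordinates `x₁`, `x₂`
(plunge and pitch) are `x 0`, `x 1`, and their velocities `y₁`, `y₂` are `y 0`, `y 1`. -/

namespace Airfoil

/-- The functions `G¹`, `G²` of the airfoil model in KCC standard form. -/
noncomputable def G (M V : ℝ) (x y : Fin 2 → ℝ) : Fin 2 → ℝ :=
  ![1 / (2100 * V ^ 2 * M) *
      (6 * V ^ 2 * M ^ 2 * x 1 ^ 3 - 6000 * M * x 1 ^ 3 + 30 * V ^ 2 * x 1 + 30 * V ^ 2 * y 0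
        + 19 * V ^ 2 * y 1 + 240 * V * M * y 0 - 60 * V * M * y 1 + 1200 * M * x 0
        - 300 * M * x 1),
    -(1 / (5250 * V ^ 2 * M)) *
      (18 * V ^ 2 * M ^ 2 * x 1 ^ 3 - 60000 * M * x 1 ^ 3 + 90 * V ^ 2 * x 1 + 90 * V ^ 2 * y 0
        + 85 * V ^ 2 * y 1 + 300 * V * M * y 0 - 600 * V * M * y 1 + 1500 * M * x 0
        - 3000 * M * x 1)]

def R1 (M V : ℝ) : ℝ :=
  -9450 * V ^ 2 * M - 43 * V ^ 2 + 135 * V * M + 621900 * M ^ 2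

def R2 (M V : ℝ) : ℝ :=
  1800 * V ^ 4 * M + 1500 * V ^ 3 * M ^ 2 - 15660000 * V ^ 2 * M ^ 3 + 4 * V ^ 4
    + 20 * V ^ 3 * M - 123675 * V ^ 2 * M ^ 2 + 297000 * V * M ^ 3 + 769590000 * M ^ 4

def R3 (M V : ℝ) : ℝ := -V ^ 2 + 50 * M

def R4 (M V : ℝ) : ℝ := V ^ 2 * M - 5000

def R5 (M V : ℝ) : ℝ :=
  -18900 * V ^ 4 * M ^ 2 + 43 * V ^ 4 * M - 135 * V ^ 3 * M ^ 2 + 795600 * V ^ 2 * M ^ 3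
    + 47250000 * V ^ 2 * M - 215000 * V ^ 2 + 675000 * V * M - 1615500000 * M ^ 2

def R6 (M V : ℝ) : ℝ :=
  3600 * V ^ 6 * M ^ 2 + 3000 * V ^ 5 * M ^ 3 - 31320000 * V ^ 4 * M ^ 4 - 4 * V ^ 6 * M
    - 20 * V ^ 5 * M ^ 2 - 146325 * V ^ 4 * M ^ 3 - 522000 * V ^ 3 * M ^ 4
    + 1579410000 * V ^ 2 * M ^ 5 - 4500000 * V ^ 4 * M - 532500000 * V ^ 3 * M ^ 2
    + 155250000000 * V ^ 2 * M ^ 3 + 20000 * V ^ 4 + 100000 * V ^ 3 * M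
    + 56625000 * V ^ 2 * M ^ 2 + 28485000000 * V * M ^ 3 - 7829550000000 * M ^ 4

/-- The genericity condition `C*`. -/
def CStar (M V : ℝ) : Prop :=
  (M - 10) * R1 M V * R2 M V * R3 M V * R4 M V * R5 M V * R6 M V ≠ 0

def C1 (M V : ℝ) : Prop :=
  (0 < R1 M V ∧ 0 < R2 M V ∧ 0 < R4 M V ∧ 0 < R5 M V ∧ 0 < R6 M V) ∧ CStar M V

def C2 (M V : ℝ) : Prop :=
  (0 < R1 M V ∧ 0 < R2 M V ∧ 0 < R3 M V ∧ R4 M V < 0) ∧ CStar M V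

def C3 (M V : ℝ) : Prop :=
  (0 < R1 M V ∧ 0 < R2 M V ∧ 0 < R3 M V ∧ 0 < R4 M V ∧ R5 M V < 0 ∧ 0 < R6 M V) ∧ CStar M V

def C4 (M V : ℝ) : Prop :=
  (R1 M V < 0 ∧ R3 M V < 0 ∧ R4 M V < 0 ∧ 0 < R5 M V ∧ 0 < R6 M V) ∧ CStar M V

def C5 (M V : ℝ) : Prop :=
  (0 < R1 M V ∧ R2 M V < 0 ∧ R3 M V < 0 ∧ R4 M V < 0 ∧ 0 < R5 M V ∧ 0 < R6 M V) ∧ CStar M V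

end Airfoil

/-! Since `G` is affine in the velocities, the connection `N` is constant and `P = -2 ∂G/∂x + N²`.
For a 2 × 2 real matrix, stability means trace < 0 < det. Eliminating the plunge leaves the pitch
equation `z (M R4 z² - 5 R3) = 0`: the origin, plus an opposite pair exactly when `R3/R4 > 0`. Up to
positive factors (trace, det) is `(-R1, R2)` at the origin and `(R5/R4, -R6/R4)` at both points of
the pair, as `P` only sees `z²`. Two inequalities settle the sign patterns. `R3, R4 > 0` forces `R6
> 0`, so a stable pair needs `R3, R4 < 0`; `R1, R2 > 0` forces `R3 > 0`, so a stable pair excludes a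
stable origin. Hence one stable point means `R1, R2 > 0`, which `C1`, `C2`, `C3` split up, and two
means a stable pair. -/

/-- Both roots of the real quadratic `z² - T z + D` lie in the open left half-plane
iff `T < 0 < D`. -/
theorem quadratic_roots_re_neg_iff (T D : ℝ) :
    (∀ z : ℂ, z ^ 2 - T * z + D = 0 → z.re < 0) ↔ T < 0 ∧ 0 < D := by
  constructor
  · intro h
    by_cases hd : 0 ≤ T ^ 2 - 4 * D
    · have hs := Real.sq_sqrt hd
      have hs0 := Real.sqrt_nonneg (T ^ 2 - 4 * D)
      set s := Real.sqrt (T ^ 2 - 4 * D)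
      -- The larger real root suffices: `T + s < 0` with `s ≥ 0` gives `T < 0` and `s² < T²`.
      have h1 := h (((T + s) / 2 : ℝ) : ℂ) (by
        norm_cast
        linear_combination (1 / 4) * hs)
      rw [Complex.ofReal_re] at h1
      exact ⟨by linarith, by nlinarith⟩
    · have hd' : 0 ≤ 4 * D - T ^ 2 := by linarith
      have hs := Real.sq_sqrt hd'
      set s := Real.sqrt (4 * D - T ^ 2)
      have h1 := h ⟨T / 2, s / 2⟩ (by
        apply Complex.ext
        · simp [pow_two]
          linear_combination (-1 / 4) * hs
        · simp [pow_two]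
          ring)
      simp only at h1
      exact ⟨by linarith, by nlinarith⟩
  · rintro ⟨hT, hD⟩ z hz
    have hre := congrArg Complex.re hz
    have him := congrArg Complex.im hz
    simp [pow_two] at hre him
    by_contra! hneg
    have him' : z.im * (2 * z.re - T) = 0 := by linear_combination him
    rcases mul_eq_zero.1 him' with h0 | h0
    · rw [h0] at hre
      nlinarith
    · linarith

/-- A complex number is an eigenvalue of a `2 × 2` matrix iff it is a root of its characteristic
polynomial. -/
theorem hasEigenvalue_toLin'_fin_two_iff (A : Matrix (Fin 2) (Fin 2) ℂ) (z : ℂ) :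
    Module.End.HasEigenvalue (Matrix.toLin' A) z ↔
      z ^ 2 - (A 0 0 + A 1 1) * z + (A 0 0 * A 1 1 - A 0 1 * A 1 0) = 0 := by
  rw [Module.End.hasEigenvalue_iff_isRoot_charpoly, Matrix.charpoly_toLin', Polynomial.IsRoot.def,
    Matrix.charpoly_fin_two]
  simp [Matrix.trace_fin_two, Matrix.det_fin_two]

namespace KCC

theorem jacobiStableAt_fin_two_iff (G : (Fin 2 → ℝ) → (Fin 2 → ℝ) → Fin 2 → ℝ)
    (x y : Fin 2 → ℝ) :
    JacobiStableAt G x y ↔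
      (deviationTensor G x y).trace < 0 ∧ 0 < (deviationTensor G x y).det := by
  rw [← quadratic_roots_re_neg_iff, Matrix.trace_fin_two, Matrix.det_fin_two]
  unfold JacobiStableAt
  refine forall_congr' fun z => ?_
  rw [hasEigenvalue_toLin'_fin_two_iff]
  simp

end KCC

namespace Airfoil

open KCC

/-! ### Deviation tensor: trace and determinant at the fixed points -/

section Tensor

/-- The (constant) matrix of the nonlinear connection of the airfoil model. -/
noncomputable def connectionMatrix (M V : ℝ) : Matrix (Fin 2) (Fin 2) ℝ :=
  !![1 / (2100 * V ^ 2 * M) * (30 * V ^ 2 + 240 * V * M),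
      1 / (2100 * V ^ 2 * M) * (19 * V ^ 2 - 60 * V * M);
    -(1 / (5250 * V ^ 2 * M)) * (90 * V ^ 2 + 300 * V * M),
      -(1 / (5250 * V ^ 2 * M)) * (85 * V ^ 2 - 600 * V * M)]

/-- The matrix `∂G^i/∂x_j` of the airfoil model, as a function of the squared pitch `c`. -/
noncomputable def stiffnessMatrix (M V c : ℝ) : Matrix (Fin 2) (Fin 2) ℝ :=
  !![1 / (2100 * V ^ 2 * M) * (1200 * M),
      1 / (2100 * V ^ 2 * M) *
        (3 * c * (6 * V ^ 2 * M ^ 2 - 6000 * M) + 30 * V ^ 2 - 300 * M);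
    -(1 / (5250 * V ^ 2 * M)) * (1500 * M),
      -(1 / (5250 * V ^ 2 * M)) *
        (3 * c * (18 * V ^ 2 * M ^ 2 - 60000 * M) + 90 * V ^ 2 - 3000 * M)]

/-- Along each coordinate line `G` is a cubic without quadratic term, so this one rule gives every
partial derivative. -/
theorem deriv_of_eq_cubic {f : ℝ → ℝ} (a b c r : ℝ) (h : ∀ s, f s = a * s ^ 3 + b * s + c) :
    deriv f r = 3 * a * r ^ 2 + b := by
  have hd : HasDerivAt (fun s : ℝ => a * s ^ 3 + b * s + c) (a * (3 * r ^ 2) + b) r := by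
    simpa using (((hasDerivAt_pow 3 r).const_mul a).add
      ((hasDerivAt_id r).const_mul b)).add_const c
  rw [funext h, hd.deriv]
  ring

theorem nonlinearConnection_eq (M V : ℝ) (i j : Fin 2) (x y : Fin 2 → ℝ) :
    nonlinearConnection (G M V) i j x y = connectionMatrix M V i j := by
  unfold nonlinearConnection partialDeriv
  rw [deriv_of_eq_cubic 0 (connectionMatrix M V i j)
    (G M V x y i - connectionMatrix M V i j * y j) (y j)]
  · ring
  · intro s
    fin_cases i <;> fin_cases j <;> simp [G, connectionMatrix] <;> ring

theorem partialDeriv_position_eq (M V : ℝ) (i j : Fin 2) (x y : Fin 2 → ℝ) :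
    partialDeriv (fun x' => G M V x' y i) j x = stiffnessMatrix M V (x 1 ^ 2) i j := by
  unfold partialDeriv
  fin_cases j
  · rw [deriv_of_eq_cubic 0 (stiffnessMatrix M V (x 1 ^ 2) i 0)
      (G M V x y i - stiffnessMatrix M V (x 1 ^ 2) i 0 * x 0)]
    · simp
    · intro s
      fin_cases i <;> simp [G, stiffnessMatrix] <;> ring
  -- The pitch entry of the stiffness matrix is affine in `c`: its value at `c = 0` is the linear
  -- coefficient, its slope three times the cubic one.
  · have key : ∀ s, G M V (Function.update x 1 s) y i =
        (stiffnessMatrix M V 1 i 1 - stiffnessMatrix M V 0 i 1) / 3 * s ^ 3 +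
          stiffnessMatrix M V 0 i 1 * s + G M V (Function.update x 1 0) y i := by
      intro s
      fin_cases i <;> simp [G, stiffnessMatrix] <;> ring
    have h := deriv_of_eq_cubic _ _ _ (x 1) key
    refine Eq.trans h ?_
    fin_cases i <;> simp [stiffnessMatrix] <;> ring

theorem deviationTensor_eq (M V : ℝ) (x : Fin 2 → ℝ) :
    deviationTensor (G M V) x 0 =
      (-2 : ℝ) • stiffnessMatrix M V (x 1 ^ 2) + connectionMatrix M V * connectionMatrix M V := by
  ext i j
  have hB : ∀ l, berwaldConnection (G M V) i j l x 0 = 0 := by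
    intro l
    unfold berwaldConnection partialDeriv
    simp [nonlinearConnection_eq]
  simp [deviationTensor, hB, nonlinearConnection_eq, partialDeriv_position_eq, Matrix.mul_apply]

theorem trace_deviationTensor_origin {M V : ℝ} (hM : 0 < M) (hV : V ≠ 0) {x : Fin 2 → ℝ}
    (hx : x 1 = 0) :
    (deviationTensor (G M V) x 0).trace = -R1 M V / (275625 * V ^ 2 * M ^ 2) := by
  have := hM.ne'
  rw [deviationTensor_eq, hx, Matrix.trace_fin_two]
  simp [stiffnessMatrix, connectionMatrix, R1]
  field_simp
  ring

theorem det_deviationTensor_origin {M V : ℝ} (hM : 0 < M) (hV : V ≠ 0) {x : Fin 2 → ℝ}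
    (hx : x 1 = 0) :
    (deviationTensor (G M V) x 0).det = R2 M V / (689062500 * V ^ 4 * M ^ 4) := by
  have := hM.ne'
  rw [deviationTensor_eq, hx, Matrix.det_fin_two]
  simp [stiffnessMatrix, connectionMatrix, R2]
  field_simp
  ring

theorem trace_deviationTensor_pair {M V : ℝ} (hM : 0 < M) (hV : V ≠ 0) (h4 : R4 M V ≠ 0)
    {x : Fin 2 → ℝ} (hx : M * R4 M V * x 1 ^ 2 = 5 * R3 M V) :
    (deviationTensor (G M V) x 0).trace = R5 M V / R4 M V / (275625 * V ^ 2 * M ^ 2) := by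
  have hM0 := hM.ne'
  have hc : x 1 ^ 2 = 5 * R3 M V / (M * R4 M V) := by
    field_simp
    linarith
  rw [deviationTensor_eq, hc, Matrix.trace_fin_two]
  simp [stiffnessMatrix, connectionMatrix]
  field_simp
  simp only [R3, R4, R5]
  ring

theorem det_deviationTensor_pair {M V : ℝ} (hM : 0 < M) (hV : V ≠ 0) (h4 : R4 M V ≠ 0)
    {x : Fin 2 → ℝ} (hx : M * R4 M V * x 1 ^ 2 = 5 * R3 M V) :
    (deviationTensor (G M V) x 0).det = -(R6 M V / R4 M V) / (689062500 * V ^ 4 * M ^ 4) := by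
  have hM0 := hM.ne'
  have hc : x 1 ^ 2 = 5 * R3 M V / (M * R4 M V) := by
    field_simp
    linarith
  rw [deviationTensor_eq, hc, Matrix.det_fin_two]
  simp [stiffnessMatrix, connectionMatrix]
  field_simp
  simp only [R3, R4, R6]
  ring

end Tensor

/-! ### Fixed points and their stability -/

section Stability

theorem jacobiStableAt_origin_iff {M V : ℝ} (hM : 0 < M) (hV : V ≠ 0) {x : Fin 2 → ℝ}
    (hx : x 1 = 0) : JacobiStableAt (G M V) x 0 ↔ 0 < R1 M V ∧ 0 < R2 M V := by
  rw [jacobiStableAt_fin_two_iff, trace_deviationTensor_origin hM hV hx,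
    det_deviationTensor_origin hM hV hx, div_lt_iff₀ (by positivity), lt_div_iff₀ (by positivity)]
  simp

theorem jacobiStableAt_pair_iff {M V : ℝ} (hM : 0 < M) (hV : V ≠ 0) (h4 : R4 M V ≠ 0)
    {x : Fin 2 → ℝ} (hx : M * R4 M V * x 1 ^ 2 = 5 * R3 M V) :
    JacobiStableAt (G M V) x 0 ↔ R5 M V / R4 M V < 0 ∧ R6 M V / R4 M V < 0 := by
  rw [jacobiStableAt_fin_two_iff, trace_deviationTensor_pair hM hV h4 hx,
    det_deviationTensor_pair hM hV h4 hx, div_lt_iff₀ (by positivity), lt_div_iff₀ (by positivity)]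
  simp

/-- The plunge coordinate of a fixed point, as a function of its pitch coordinate. -/
noncomputable def plunge (M V z : ℝ) : ℝ :=
  -(6 * V ^ 2 * M ^ 2 * z ^ 3 - 6000 * M * z ^ 3 + 30 * V ^ 2 * z - 300 * M * z) / (1200 * M)

theorem isFixedPoint_iff {M V : ℝ} (hM : 0 < M) (hV : V ≠ 0) (x : Fin 2 → ℝ) :
    IsFixedPoint (G M V) x ↔
      x 0 = plunge M V (x 1) ∧ (x 1 = 0 ∨ M * R4 M V * x 1 ^ 2 = 5 * R3 M V) := by
  have hM0 := hM.ne'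
  have h : (x 1 = 0 ∨ M * R4 M V * x 1 ^ 2 = 5 * R3 M V) ↔
      x 1 * (M * R4 M V * x 1 ^ 2 - 5 * R3 M V) = 0 := by
    rw [mul_eq_zero, sub_eq_zero]
  rw [h, plunge, eq_div_iff (by positivity)]
  simp only [IsFixedPoint, Fin.forall_fin_two, G, R3, R4, Pi.zero_apply, Matrix.cons_val_zero,
    Matrix.cons_val_one]
  rw [mul_eq_zero, mul_eq_zero, or_iff_right (by positivity),
    or_iff_right (neg_ne_zero.2 (by positivity))]
  constructor
  · rintro ⟨h1, h2⟩
    -- Subtracting `5/4 = 1500/1200` times the first bracket from the second cancels the plunge;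
    -- `2/21` normalizes the rest.
    exact ⟨by linear_combination h1, by linear_combination (2 / 21) * h2 - (5 / 42) * h1⟩
  · rintro ⟨h1, h2⟩
    exact ⟨by linear_combination h1, by linear_combination (21 / 2) * h2 + (5 / 4) * h1⟩

/-- A fixed point is determined by its pitch, so counting reduces to the real line. -/
theorem encard_jacobiStableFixedPoints {M V : ℝ} (hM : 0 < M) (hV : V ≠ 0) (h4 : R4 M V ≠ 0) :
    (jacobiStableFixedPoints (G M V)).encard =
      {z : ℝ | (z = 0 ∧ 0 < R1 M V ∧ 0 < R2 M V) ∨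
        (M * R4 M V * z ^ 2 = 5 * R3 M V ∧ R5 M V / R4 M V < 0 ∧ R6 M V / R4 M V < 0)}.encard := by
  have hinj : Function.Injective fun z : ℝ => (![plunge M V z, z] : Fin 2 → ℝ) :=
    fun z w h => by simpa using congrFun h 1
  rw [← hinj.encard_image]
  congr 1
  ext x
  simp only [jacobiStableFixedPoints, Set.mem_ofPred_eq, Set.mem_image]
  rw [isFixedPoint_iff hM hV]
  constructor
  · rintro ⟨⟨h0, h1⟩, hs⟩
    refine ⟨x 1, ?_, ?_⟩
    · rcases h1 with h1 | h1
      · exact Or.inl ⟨h1, (jacobiStableAt_origin_iff hM hV h1).1 hs⟩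
      · exact Or.inr ⟨h1, (jacobiStableAt_pair_iff hM hV h4 h1).1 hs⟩
    · ext i
      fin_cases i
      · exact h0.symm
      · rfl
  · rintro ⟨z, hz, rfl⟩
    rcases hz with ⟨hz, hs⟩ | ⟨hz, hs⟩
    · exact ⟨⟨rfl, Or.inl hz⟩, (jacobiStableAt_origin_iff hM hV (by exact hz)).2 hs⟩
    · exact ⟨⟨rfl, Or.inr hz⟩, (jacobiStableAt_pair_iff hM hV h4 (by exact hz)).2 hs⟩

end Stability

/-! ### Counting -/

section Count

/-- Number of points of a set made of the origin and a pair of opposite numbers, each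
present or not. -/
theorem encard_origin_or_pair {a b : ℝ} (ha : a ≠ 0) (hb : b ≠ 0) (p q : Prop) :
    ({z : ℝ | (z = 0 ∧ p) ∨ (a * z ^ 2 = b ∧ q)}.encard = 1 ↔ p ∧ ¬(0 < b / a ∧ q)) ∧
    ({z : ℝ | (z = 0 ∧ p) ∨ (a * z ^ 2 = b ∧ q)}.encard = 2 ↔ ¬p ∧ (0 < b / a ∧ q)) := by
  have hsq : ∀ z : ℝ, a * z ^ 2 = b ↔ z ^ 2 = b / a := fun z => by
    rw [eq_div_iff ha, mul_comm]
  by_cases hq : 0 < b / a ∧ q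
  · obtain ⟨w, hw, hww⟩ : ∃ w : ℝ, 0 < w ∧ b / a = w ^ 2 :=
      ⟨√(b / a), Real.sqrt_pos.2 hq.1, (Real.sq_sqrt hq.1.le).symm⟩
    have hne : w ≠ -w := by linarith
    have hpair : {z : ℝ | a * z ^ 2 = b} = {w, -w} := by
      ext z
      simp [hsq, hww, sq_eq_sq_iff_eq_or_eq_neg]
    by_cases hp : p
    · have hset : {z : ℝ | (z = 0 ∧ p) ∨ (a * z ^ 2 = b ∧ q)} = insert 0 {w, -w} := by
        rw [← hpair]
        ext z
        simp [hp, hq.2]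
      have h0 : (0 : ℝ) ∉ ({w, -w} : Set ℝ) := by simp [hw.ne, hw.ne']
      rw [hset, Set.encard_insert_of_notMem h0, Set.encard_pair hne]
      simp [hp, hq]
    · have hset : {z : ℝ | (z = 0 ∧ p) ∨ (a * z ^ 2 = b ∧ q)} = {w, -w} := by
        rw [← hpair]
        ext z
        simp [hp, hq.2]
      rw [hset, Set.encard_pair hne]
      simp [hp, hq]
  · have hpair : ∀ z : ℝ, ¬(a * z ^ 2 = b ∧ q) := by
      rintro z ⟨h, h'⟩
      have hpos : b / a ≤ 0 := not_lt.1 fun h0 => hq ⟨h0, h'⟩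
      have hz : z ^ 2 = b / a := (hsq z).1 h
      have : b / a = 0 := le_antisymm hpos (hz ▸ sq_nonneg z)
      exact div_ne_zero hb ha this
    by_cases hp : p
    · have hset : {z : ℝ | (z = 0 ∧ p) ∨ (a * z ^ 2 = b ∧ q)} = {0} := by
        ext z
        simp [hp, hpair]
      rw [hset, Set.encard_singleton]
      simp [hp, hq]
    · have hset : {z : ℝ | (z = 0 ∧ p) ∨ (a * z ^ 2 = b ∧ q)} = ∅ := by
        ext z
        simp [hp, hpair]
      rw [hset, Set.encard_empty]
      simp [hp, hq]

end Count

/-! ### Sign relations between the polynomials -/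

section Inequalities

/-- If the origin is Jacobi stable then `R3` is positive. -/
theorem R3_pos_of_R1_pos_of_R2_pos {M V : ℝ} (hM : 0 < M) (h1 : 0 < R1 M V) (h2 : 0 < R2 M V) :
    0 < R3 M V := by
  by_contra! h3
  -- With `t = V/M` and `s = M t²`, a power of `M` factors out and both polynomials become affine in
  -- `s`.
  obtain ⟨t, rfl⟩ : ∃ t, V = M * t := ⟨V / M, by field_simp⟩
  have hs : 50 ≤ M * t ^ 2 := by
    have : M * 50 ≤ M * (M * t ^ 2) := by
      simp only [R3] at h3
      linarith
    exact le_of_mul_le_mul_left this hM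
  have e1 : R1 M (M * t) = M ^ 2 * (-9450 * (M * t ^ 2) - 43 * t ^ 2 + 135 * t + 621900) := by
    simp only [R1]
    ring
  have e2 : R2 M (M * t) = M ^ 4 * ((M * t ^ 2) * (1800 * t ^ 2 + 1500 * t - 15660000)
      + 4 * t ^ 4 + 20 * t ^ 3 - 123675 * t ^ 2 + 297000 * t + 769590000) := by
    simp only [R2]
    ring
  rw [e1] at h1
  rw [e2] at h2
  have h1' := pos_of_mul_pos_right h1 (by positivity)
  have h2' := pos_of_mul_pos_right h2 (by positivity)
  generalize M * t ^ 2 = s at hs h1' h2'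
  have hq : 43 * t ^ 2 - 135 * t < 149400 := by linarith
  have hu : t < 61 := by nlinarith
  have hl : -61 < t := by nlinarith
  have ht2 : t ^ 2 < 3721 := by nlinarith
  have hcoef : 1800 * t ^ 2 + 1500 * t - 15660000 < 0 := by nlinarith
  -- `R2` decreases in `s`, so its value at `s = 50` bounds it.
  have hmono : (s - 50) * (1800 * t ^ 2 + 1500 * t - 15660000) ≤ 0 :=
    mul_nonpos_of_nonneg_of_nonpos (by linarith) hcoef.le
  have h50 : 4 * t ^ 4 + 20 * t ^ 3 - 33675 * t ^ 2 + 372000 * t - 13410000 ≤ 0 := by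
    have : t ^ 2 * (4 * t ^ 2 + 20 * t - 16200) ≤ 0 :=
      mul_nonpos_of_nonneg_of_nonpos (sq_nonneg t) (by linarith)
    nlinarith [sq_nonneg (t - 11)]
  linarith

/-- If `R3` and `R4` are positive then so is `R6`. -/
theorem R6_pos_of_R3_pos_of_R4_pos {M V : ℝ} (hM : 0 < M) (h3 : 0 < R3 M V) (h4 : 0 < R4 M V) :
    0 < R6 M V := by
  have h10 : 10 < M := by
    simp only [R3, R4] at h3 h4
    nlinarith
  obtain ⟨t, rfl⟩ : ∃ t, V = M * t := ⟨V / M, by field_simp⟩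
  obtain ⟨a, ha⟩ : ∃ a, a = 50 - M * t ^ 2 := ⟨_, rfl⟩
  obtain ⟨b, hb⟩ : ∃ b, b = M ^ 3 * t ^ 2 - 5000 := ⟨_, rfl⟩
  have ha0 : 0 < a := by
    have e : R3 M (M * t) = M * a := by
      simp only [R3, ha]
      ring
    exact pos_of_mul_pos_right (e ▸ h3) hM.le
  have hb0 : 0 < b := by
    have e : R4 M (M * t) = b := by
      simp only [R4, hb]
      ring
    exact e ▸ h4
  have ht5 : t ^ 2 < 5 := by nlinarith [sq_nonneg t]
  -- In `a = R3/M` and `b = R4` no constant term remains and the coefficients involve only `t`; they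
  -- are positive for `t² < 5`.
  have e6 : R6 M (M * t) = M ^ 4 *
      (a * (1350000000 + 517500000 * t - 13500000 * t ^ 2)
        + b * (13410000 - 372000 * t - 20 * t ^ 3 + 33675 * t ^ 2 - 4 * t ^ 4)
        + a * b * (31320000 - 3000 * t - 3600 * t ^ 2)) := by
    simp only [R6, ha, hb]
    ring
  have hu : t < 9 / 4 := by nlinarith
  have hl : -(9 / 4) < t := by nlinarith
  have c1 : 0 < 1350000000 + 517500000 * t - 13500000 * t ^ 2 := by linarith
  have c2 : 0 < 13410000 - 372000 * t - 20 * t ^ 3 + 33675 * t ^ 2 - 4 * t ^ 4 := by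
    have h : t ^ 2 * (33675 - 20 * t - 4 * t ^ 2) ≥ 0 :=
      mul_nonneg (sq_nonneg t) (by linarith)
    linarith
  have c3 : 0 < 31320000 - 3000 * t - 3600 * t ^ 2 := by linarith
  rw [e6]
  positivity

end Inequalities

end Airfoil

theorem mainTheorem4 (M V : ℝ) (hM : 0 < M) (hV : V ≠ 0) (hgen : Airfoil.CStar M V) :
    ((KCC.jacobiStableFixedPoints (Airfoil.G M V)).encard = 1 ↔
      Airfoil.C1 M V ∨ Airfoil.C2 M V ∨ Airfoil.C3 M V) ∧
    ((KCC.jacobiStableFixedPoints (Airfoil.G M V)).encard = 2 ↔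
      Airfoil.C4 M V ∨ Airfoil.C5 M V) := by
  have hne := hgen
  simp only [Airfoil.CStar, mul_ne_zero_iff] at hne
  obtain ⟨⟨⟨⟨⟨⟨-, h1⟩, h2⟩, h3⟩, h4⟩, h5⟩, h6⟩ := hne
  have hcount := Airfoil.encard_origin_or_pair (mul_ne_zero hM.ne' h4)
    (mul_ne_zero (by norm_num : (5 : ℝ) ≠ 0) h3) (0 < Airfoil.R1 M V ∧ 0 < Airfoil.R2 M V)
    (Airfoil.R5 M V / Airfoil.R4 M V < 0 ∧ Airfoil.R6 M V / Airfoil.R4 M V < 0)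
  rw [← Airfoil.encard_jacobiStableFixedPoints hM hV h4] at hcount
  have hpair : 0 < 5 * Airfoil.R3 M V / (M * Airfoil.R4 M V) ↔
      0 < Airfoil.R3 M V / Airfoil.R4 M V := by
    rw [mul_div_mul_comm]
    exact mul_pos_iff_of_pos_left (by positivity)
  rw [hcount.1, hcount.2, hpair, div_pos_iff, div_neg_iff, div_neg_iff]
  have hR3 := Airfoil.R3_pos_of_R1_pos_of_R2_pos (V := V) hM
  have hR6 := Airfoil.R6_pos_of_R3_pos_of_R4_pos (V := V) hM
  simp only [Airfoil.C1, Airfoil.C2, Airfoil.C3, Airfoil.C4, Airfoil.C5, hgen, and_true]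
  generalize Airfoil.R1 M V = r1 at *
  generalize Airfoil.R2 M V = r2 at *
  generalize Airfoil.R3 M V = r3 at *
  generalize Airfoil.R4 M V = r4 at *
  generalize Airfoil.R5 M V = r5 at *
  generalize Airfoil.R6 M V = r6 at *
  clear hcount hpair hgen
  -- By genericity only the 64 sign patterns remain; `hR3` and `hR6` discard the impossible ones.
  rcases lt_or_gt_of_ne h1 with k1 | k1 <;> rcases lt_or_gt_of_ne h2 with k2 | k2 <;>
  rcases lt_or_gt_of_ne h3 with k3 | k3 <;> rcases lt_or_gt_of_ne h4 with k4 | k4 <;>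
  rcases lt_or_gt_of_ne h5 with k5 | k5 <;> rcases lt_or_gt_of_ne h6 with k6 | k6 <;>
  simp_all [not_lt_of_gt]
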